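/- Let $K$ be a finite field, let $R$ be a finite dimensional unital associative $K$-algebra, let $D$ be a skew field that is a $K$-algebra of countable dimension, and suppose that $D$ is amenable: there are finite dimensional $K$-subspaces $W_1,W_2,\dots\subset D$ with $$\lim_{n\to\infty}\frac{\dim_K(W_n+aW_n)}{\dim_K(W_n)}=1\qquad\text{for every } a\in D.$$ Let $l\ge 1$ and let $\rho:R\to \mathrm{Mat}_{l\times l}(D)$ be a unital homomorphism of $K$-algebras. For a matrix $A\in\mathrm{Mat}_{k\times m}(R)$ put $$\mathrm{rk}_\rho(A)=\tfrac1l\,\mathrm{rank}_D(\tilde\rho(A)),$$ where $\tilde\rho(A)\in \mathrm{Mat}_{kl\times ml}(D)$ is obtained by applying $\rho$ to every entry of $A$, and $\mathrm{rank}_D$ is the dimension of the right $D$-space spanned by the columns. Then $\mathrm{rk}_\rho$ is an amenable element of the rank spectrum of $R$. That is: (a) $\mathrm{rk}_\rho$ belongs to the rank spectrum of $R$, the set of all functions $A\mapsto \mathrm{rank}_S(\tilde\sigma(A))$ on the finite matrices over $R$, where $\sigma:R\to S$ is a unital $K$-algebra homomorphism into a von Neumann regular $K$-algebra $S$ equipped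 with a Sylvester rank function $\mathrm{rank}_S$ on the finite matrices over $S$ such that $\mathrm{rank}_S(A)=0$ implies $A=0$. (A Sylvester rank function is a real-valued function $\mathrm{rk}$ on finite matrices with $\mathrm{rk}(I)=1$ for the $1\times1$ matrix $I=(1)$, $\mathrm{rk}\begin{pmatrix}A&0\\0&B\end{pmatrix}=\mathrm{rk}(A)+\mathrm{rk}(B)$, $\mathrm{rk}\begin{pmatrix}A&0\\C&B\end{pmatrix}\ge\mathrm{rk}(A)+\mathrm{rk}(B)$ and $\mathrm{rk}(AB)\le\min(\mathrm{rk}(A),\mathrm{rk}(B))$ for matrices of appropriate sizes.) (b) There is a sequence $M_1,M_2,\dots$ of nonzero finitely generated left $R$-modules such that for every $k,m$ and every $A\in \mathrm{Mat}_{k\times m}(R)$ $$\lim_{n\to\infty}\frac{\dim_K\big(A\cdot M_n^m\big)}{\dim_K(M_n)}=\mathrm{rk}_\rho(A),$$ where $A\cdot M_n^m\subset M_n^k$ is the image of the $K$-linear map $M_n^m\to M_n^k$ given by $A$, and which is hyperfinite: for every $\varepsilon>0$ there is a finite family $N_1,\dots,N_t$ of finitely generated left $R$-modules such that every $M_n$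 has a submodule $P_n$ with $\dim_K(P_n)\ge(1-\varepsilon)\dim_K(M_n)$ and $P_n\cong\bigoplus_{i=1}^t N_i^{\alpha_i}$ for some non-negative integers $\alpha_1,\dots,\alpha_t$. -/

import Mathlib

open Filter Topology

/-- Real-valued functions on `Mat(R)`, the collection of all finite matrices over `R`. -/
abbrev MatrixFunction (R : Type*) : Type _ :=
  ∀ k l : ℕ, Matrix (Fin k) (Fin l) R → ℝ

/-- The block matrix `(A 0; C B)`, with rows and columns numbered consecutively. -/
def lowerBlock {R : Type*} [Zero R] {k l m n : ℕ} (A : Matrix (Fin k) (Fin l) R)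
    (C : Matrix (Fin m) (Fin l) R) (B : Matrix (Fin m) (Fin n) R) :
    Matrix (Fin (k + m)) (Fin (l + n)) R :=
  Matrix.reindex finSumFinEquiv finSumFinEquiv (Matrix.fromBlocks A 0 C B)

/-- Sylvester rank functions. -/
structure IsSylvesterRank {R : Type*} [Ring R] (rk : MatrixFunction R) : Prop where
  one : rk 1 1 1 = 1
  diag : ∀ {k l m n : ℕ} (A : Matrix (Fin k) (Fin l) R) (B : Matrix (Fin m) (Fin n) R),
    rk (k + m) (l + n) (lowerBlock A 0 B) = rk k l A + rk m n B
  triangular : ∀ {k l m n : ℕ} (A : Matrix (Fin k) (Fin l) R) (C : Matrix (Fin m) (Fin l) R)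
    (B : Matrix (Fin m) (Fin n) R),
    rk k l A + rk m n B ≤ rk (k + m) (l + n) (lowerBlock A C B)
  mul : ∀ {k l m : ℕ} (A : Matrix (Fin k) (Fin l) R) (B : Matrix (Fin l) (Fin m) R),
    rk k m (A * B) ≤ min (rk k l A) (rk l m B)

/-- `S`, equipped with `rk`, is a rank algebra: `S` is von Neumann regular and `rk` is a
faithful Sylvester rank function on `Mat(S)`. -/
structure IsRankAlgebra (S : Type*) [Ring S] (rk : MatrixFunction S) : Prop where
  regular : ∀ a : S, ∃ x : S, a * x * a = a
  sylvester : IsSylvesterRank rk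
  faithful : ∀ {k l : ℕ} (A : Matrix (Fin k) (Fin l) S), rk k l A = 0 → A = 0

/-- The function `A ↦ rk (ρ̃ A)`, where `ρ̃` applies `ρ` to every entry. -/
def rankOfRep {K R S : Type*} [Field K] [Ring R] [Algebra K R] [Ring S] [Algebra K S]
    (rk : MatrixFunction S) (ρ : R →ₐ[K] S) : MatrixFunction R :=
  fun k l A => rk k l (A.map ρ)

universe uK uR uS

/-- The rank spectrum of `R`: all functions `rk_ρ`, where `ρ` is a representation of `R` into
a rank algebra over `K`. -/
def rankSpectrum (K : Type uK) (R : Type uR) [Field K] [Ring R] [Algebra K R] :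
    Set (MatrixFunction R) :=
  {f | ∃ (S : Type uS) (_ : Ring S) (_ : Algebra K S) (rk : MatrixFunction S) (ρ : R →ₐ[K] S),
    IsRankAlgebra S rk ∧ f = rankOfRep rk ρ}

/-- The finitely generated left modules over the `K`-algebra `R`, with the `K`-vector space
structure that the `R`-module structure induces. -/
structure FinMod (K : Type uK) (R : Type uR) [Field K] [Ring R] [Algebra K R] where
  carrier : Type uR
  [addCommGroup : AddCommGroup carrier]
  [moduleR : Module R carrier]
  [moduleK : Module K carrier]
  [tower : IsScalarTower K R carrier]
  [finite : Module.Finite R carrier]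

instance {K R : Type*} [Field K] [Ring R] [Algebra K R] :
    CoeSort (FinMod K R) (Type _) := ⟨FinMod.carrier⟩

attribute [instance] FinMod.addCommGroup FinMod.moduleR FinMod.moduleK FinMod.tower FinMod.finite

section

variable {K R : Type*} [Field K] [Ring R] [Algebra K R]

/-- The `K`-linear map `M^l → M^k` given by a `k × l` matrix over `R`. -/
def matrixAction (M : FinMod K R) {k l : ℕ} (A : Matrix (Fin k) (Fin l) R) :
    (Fin l → M) →ₗ[K] (Fin k → M) where
  toFun v i := ∑ j, A i j • v j
  map_add' v w := by
    funext i
    simp [smul_add, Finset.sum_add_distrib]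
  map_smul' c v := by
    funext i
    simp [Finset.smul_sum, smul_algebra_smul_comm]

/-- The function `rk_M` of a finitely generated (nonzero) module `M`. -/
noncomputable def rankOfMod (M : FinMod K R) : MatrixFunction R :=
  fun _ _ A => (Module.finrank K (LinearMap.range (matrixAction M A)) : ℝ) / Module.finrank K M

/-- Hyperfinite families of finitely generated modules. -/
def IsHyperfinite {ι : Type*} (M : ι → FinMod K R) : Prop :=
  ∀ ε : ℝ, 0 < ε → ∃ (t : ℕ) (N : Fin t → FinMod K R), ∀ n : ι,
    ∃ P : Submodule R (M n),
      (1 - ε) * Module.finrank K (M n) ≤ Module.finrank K P ∧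
      ∃ α : Fin t → ℕ, Nonempty (P ≃ₗ[R] ((i : Fin t) → Fin (α i) → N i))

end

/-- Amenable elements of the rank spectrum: limits of hyperfinite sequences of (nonzero) finitely
generated modules. -/
def IsAmenableElement (K : Type uK) {R : Type uR} [Field K] [Ring R] [Algebra K R]
    (f : MatrixFunction R) : Prop :=
  f ∈ rankSpectrum.{uK, uR, uS} K R ∧
  ∃ M : ℕ → FinMod K R, (∀ n, Nontrivial (M n)) ∧ IsHyperfinite M ∧
    ∀ (k l : ℕ) (A : Matrix (Fin k) (Fin l) R),
      Tendsto (fun n => rankOfMod (M n) k l A) atTop (𝓝 (f k l A))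

/-- (Left) amenable algebras, by a Følner sequence of finite dimensional subspaces. -/
def IsAmenableAlgebra (K A : Type*) [Field K] [Ring A] [Algebra K A] : Prop :=
  ∃ W : ℕ → Submodule K A, (∀ n, Module.Finite K (W n)) ∧
    ∀ a : A, Tendsto
      (fun n => (Module.finrank K ↥(W n ⊔ (W n).map (LinearMap.mulLeft K a)) : ℝ) /
        Module.finrank K (W n)) atTop (𝓝 1)

/-- The rank of a matrix over a skew field: the dimension of the right vector space spanned by its
columns. -/
noncomputable def skewRank {D m n : Type*} [DivisionRing D] (A : Matrix m n D) : ℕ :=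
  Module.finrank Dᵐᵒᵖ (Submodule.span Dᵐᵒᵖ (Set.range fun j i => A i j))

/-- The normalized rank function of the algebra of `l × l` matrices over a skew field: a matrix of
`l × l` blocks is read as a matrix over `D`, and its rank is divided by `l`. -/
noncomputable def matrixAlgebraRank (D : Type*) [DivisionRing D] (l : ℕ) :
    MatrixFunction (Matrix (Fin l) (Fin l) D) :=
  fun k m A => (skewRank (Matrix.comp (Fin k) (Fin m) (Fin l) (Fin l) D A) : ℝ) / l

/-!
Matrices over a skew field `D` have rank factorizations `B = C * E` with `X * C = 1` and `E * Y = 1`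
(`exists_rank_factorization`). Hence the rank of `B` is both the least size of an identity matrix
through which `B` factors and the largest size of an identity matrix that factors through `B`. The
first description gives the upper bounds and the second the lower bounds among the axioms of a
Sylvester rank function; since `Y * X` is a generalized inverse of `B`, the algebra of `l × l`
matrices over `D` is a rank algebra (`isRankAlgebra_matrixAlgebraRank`). This puts the given
function into the rank spectrum.

For the approximation, let `W n` be a Følner sequence of `D`, and let `M n` be the `R`-submodule of
`D^l` generated by `(W n)^l`. It lies between `(W n)^l` and `(L * W n)^l`, where `L` is the span of
the entries of the matrices `ρ r`. As `K` is finite, so is every finite dimensional subspace `L`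
of `D`, and the Følner condition gives `dim (L * W n) / dim (W n) → 1`
(`IsLeftFoelner.tendsto_mul`). The two descriptions of the rank then show that a matrix `B` over `D`
maps a space close to `(W n)^p` onto one of dimension about `rank B * dim (W n)`
(`exists_finrank_map_mulVecK_bounds`), and this is the convergence of the rank functions
(`tendsto_rankOfMod`).

For hyperfiniteness, let `D` be infinite dimensional, so that `dim (W n) → ∞`. Right multiplication
by a nonzero `x ∈ D` is an injective `R`-linear map of `D^l`, so `D^l` contains many copies
of `M m`. Put `V = L * W m`, with `m` so large that `M m` is almost all of `V^l`. If `n` is large,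
then `V x ⊆ W n` holds for all `x` in a subspace `X` of almost full dimension in `W n`. Because `K` is
finite, a counting argument shows that `x₁, …, x_t ∈ X` can be chosen greedily such that the
sum of the `V xᵢ` is direct and has dimension at least `dim X - dim V`
(`exists_independent_translates`). The sum of the copies `(M m) xᵢ` is then a direct sum of
copies of a single module that fills almost all of `M n`. If `D` is finite dimensional, then the
constant sequence `W n = D` can be used instead.
-/

/-! ### Ranks of matrices over a skew field -/

section SkewRank

variable {D m n : Type*} [DivisionRing D]

/-- If `A` factors through `p` columns, then its rank is at most the number of these. -/
theorem skewRank_le_card_of_eq_mul {p : Type*} [Fintype p] {A : Matrix m n D}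
    (C : Matrix m p D) (E : Matrix p n D) (h : A = C * E) : skewRank A ≤ Fintype.card p := by
  classical
  have hle : Submodule.span Dᵐᵒᵖ (Set.range fun j i => A i j) ≤
      Submodule.span Dᵐᵒᵖ (Set.range fun j i => C i j) := by
    rw [Submodule.span_le]
    rintro _ ⟨j, rfl⟩
    have : (fun i => A i j) = ∑ s : p, MulOpposite.op (E s j) • (fun i => C i s) := by
      funext i
      simp [h, Matrix.mul_apply, Finset.sum_apply]
    change (fun i => A i j) ∈ _
    rw [this]
    exact Submodule.sum_mem _ fun s _ =>
      Submodule.smul_mem _ _ (Submodule.subset_span ⟨s, rfl⟩)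
  have : Module.Finite Dᵐᵒᵖ (Submodule.span Dᵐᵒᵖ (Set.range fun j i => C i j)) :=
    Module.Finite.span_of_finite _ (Set.finite_range _)
  exact (Submodule.finrank_mono hle).trans (finrank_range_le_card (R := Dᵐᵒᵖ) fun j i => C i j)

theorem skewRank_one [Fintype m] [DecidableEq m] :
    skewRank (1 : Matrix m m D) = Fintype.card m := by
  refine finrank_span_eq_card (Fintype.linearIndependent_iff.2 fun g hg i => ?_)
  simpa [Finset.sum_apply, Matrix.one_apply] using congrFun hg i

/-- A rank factorization: a matrix of rank `r` is the product of a left invertible matrix with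
`r` columns and a right invertible matrix with `r` rows. -/
theorem exists_rank_factorization [Fintype m] [Fintype n] [DecidableEq m] [DecidableEq n]
    (A : Matrix m n D) :
    ∃ (r : ℕ) (C : Matrix m (Fin r) D) (E : Matrix (Fin r) n D)
      (X : Matrix (Fin r) m D) (Y : Matrix n (Fin r) D),
      skewRank A = r ∧ A = C * E ∧ X * C = 1 ∧ E * Y = 1 := by
  set V := Submodule.span Dᵐᵒᵖ (Set.range fun j i => A i j) with hV
  have : Module.Finite Dᵐᵒᵖ V := Module.Finite.span_of_finite _ (Set.finite_range _)
  let b : Module.Basis (Fin (skewRank A)) Dᵐᵒᵖ V := Module.finBasis Dᵐᵒᵖ V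
  have hmem : ∀ j, (fun i => A i j) ∈ V := fun j => Submodule.subset_span ⟨j, rfl⟩
  let C : Matrix m (Fin (skewRank A)) D := Matrix.of fun i s => (b s : m → D) i
  let E : Matrix (Fin (skewRank A)) n D := Matrix.of fun s j =>
    (b.repr ⟨_, hmem j⟩ s).unop
  have hACE : A = C * E := by
    ext i j
    have := congrFun (congrArg Subtype.val (b.sum_repr ⟨_, hmem j⟩)) i
    simp only [AddSubmonoidClass.coe_finsetSum, Finset.sum_apply, SetLike.val_smul,
      Pi.smul_apply] at this
    rw [← this]
    simp only [Matrix.mul_apply, C, E, Matrix.of_apply]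
    rfl
  -- the coordinates on the column space extend to the whole space
  obtain ⟨g, hg⟩ := LinearMap.exists_leftInverse_of_injective V.subtype V.ker_subtype
  let X : Matrix (Fin (skewRank A)) m D := Matrix.of fun s i =>
    (b.repr (g (Pi.single i 1)) s).unop
  have hX : ∀ (v : m → D) (s), ∑ i, X s i * v i = (b.repr (g v) s).unop := by
    intro v s
    have hv : v = ∑ i, MulOpposite.op (v i) • (Pi.single i (1 : D) : m → D) := by
      funext i
      simp [Finset.sum_apply, Pi.single_apply]
    conv_rhs => rw [hv]
    simp [X, Finset.sum_apply]
  have hXC : X * C = 1 := by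
    ext s t
    have h1 : g (b t : m → D) = b t := LinearMap.congr_fun hg (b t)
    simp only [Matrix.mul_apply, C, Matrix.of_apply]
    rw [hX, h1]
    rw [b.repr_self, Finsupp.single_apply, Matrix.one_apply, apply_ite MulOpposite.unop]
    simp only [eq_comm, MulOpposite.unop_one, MulOpposite.unop_zero]
  -- the columns of `C` are combinations of the columns of `A`
  have hY : ∀ s, ∃ c : n → Dᵐᵒᵖ, ∑ j, c j • (fun i => A i j) = (b s : m → D) := fun s =>
    (Submodule.mem_span_range_iff_exists_fun Dᵐᵒᵖ).1 (b s).2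
  choose c hc using hY
  let Y : Matrix n (Fin (skewRank A)) D := Matrix.of fun j s => (c s j).unop
  have hAY : A * Y = C := by
    ext i s
    have := congrFun (hc s) i
    simp only [Finset.sum_apply, Pi.smul_apply] at this
    simp only [C, Matrix.of_apply, ← this, Matrix.mul_apply, Y]
    rfl
  refine ⟨skewRank A, C, E, X, Y, rfl, hACE, hXC, ?_⟩
  calc E * Y = X * C * (E * Y) := by rw [hXC, Matrix.one_mul]
    _ = X * (C * E * Y) := by simp only [Matrix.mul_assoc]
    _ = 1 := by rw [← hACE, hAY, hXC]

/-- An identity matrix that factors through `A` has size at most the rank of `A`. -/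
theorem card_le_skewRank_of_mul_mul_eq_one {p : Type*} [Fintype p] [DecidableEq p]
    [Fintype m] [Fintype n] [DecidableEq m] [DecidableEq n] {A : Matrix m n D}
    (X : Matrix p m D) (Y : Matrix n p D) (h : X * A * Y = 1) :
    Fintype.card p ≤ skewRank A := by
  obtain ⟨r, C, E, -, -, hr, hA, -, -⟩ := exists_rank_factorization A
  rw [← skewRank_one (D := D) (m := p)]
  refine (skewRank_le_card_of_eq_mul (X * C) (E * Y) ?_).trans_eq (by simp [hr])
  rw [← h, hA]
  simp only [Matrix.mul_assoc]

variable [Fintype m] [Fintype n] [DecidableEq m] [DecidableEq n]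

omit [Fintype n] [DecidableEq n] in
theorem skewRank_mul_le_left {k : Type*} [Fintype k] [DecidableEq k] (A : Matrix k m D)
    (B : Matrix m n D) : skewRank (A * B) ≤ skewRank A := by
  obtain ⟨r, C, E, -, -, hr, hA, -, -⟩ := exists_rank_factorization A
  refine (skewRank_le_card_of_eq_mul C (E * B) ?_).trans_eq (by simp [hr])
  rw [hA, Matrix.mul_assoc]

theorem skewRank_mul_le_right {k : Type*} [Fintype k] [DecidableEq k] (A : Matrix k m D)
    (B : Matrix m n D) : skewRank (A * B) ≤ skewRank B := by
  obtain ⟨r, C, E, -, -, hr, hB, -, -⟩ := exists_rank_factorization B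
  refine (skewRank_le_card_of_eq_mul (A * C) E ?_).trans_eq (by simp [hr])
  rw [hB, Matrix.mul_assoc]

theorem skewRank_submatrix_le {m' n' : Type*} (A : Matrix m n D) (e : m' → m) (f : n' → n) :
    skewRank (A.submatrix e f) ≤ skewRank A := by
  obtain ⟨r, C, E, -, -, hr, hA, -, -⟩ := exists_rank_factorization A
  refine (skewRank_le_card_of_eq_mul (C.submatrix e id) (E.submatrix id f) ?_).trans_eq
    (by simp [hr])
  rw [hA]
  rfl

theorem skewRank_submatrix_equiv {m' n' : Type*} [Fintype m'] [Fintype n'] [DecidableEq m']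
    [DecidableEq n'] (A : Matrix m n D) (e : m' ≃ m) (f : n' ≃ n) :
    skewRank (A.submatrix e f) = skewRank A := by
  refine le_antisymm (skewRank_submatrix_le A e f) ?_
  simpa using skewRank_submatrix_le (A.submatrix e f) e.symm f.symm

theorem skewRank_eq_zero {A : Matrix m n D} (h : skewRank A = 0) : A = 0 := by
  obtain ⟨r, C, E, -, -, hr, hA, -, -⟩ := exists_rank_factorization A
  obtain rfl : r = 0 := hr.symm.trans h
  rw [hA]
  ext i j
  simp [Matrix.mul_apply]

variable {k l : Type*} [Fintype k] [Fintype l] [DecidableEq k] [DecidableEq l]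

/-- Ranks are superadditive on block triangular matrices: if `X₁ * A * Y₁` and `X₂ * B * Y₂` are
identity matrices, then the block diagonal matrices formed from them turn the given matrix into a
unipotent one. -/
theorem add_skewRank_le_fromBlocks (A : Matrix k l D) (C : Matrix m l D) (B : Matrix m n D) :
    skewRank A + skewRank B ≤ skewRank (Matrix.fromBlocks A 0 C B) := by
  obtain ⟨r, C₁, E₁, X₁, Y₁, hr, hA, hX₁, hY₁⟩ := exists_rank_factorization A
  obtain ⟨s, C₂, E₂, X₂, Y₂, hs, hB, hX₂, hY₂⟩ := exists_rank_factorization B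
  have h₁ : X₁ * A * Y₁ = 1 := by
    rw [hA, ← Matrix.mul_assoc, hX₁, Matrix.one_mul, hY₁]
  have h₂ : X₂ * B * Y₂ = 1 := by
    rw [hB, ← Matrix.mul_assoc, hX₂, Matrix.one_mul, hY₂]
  have := card_le_skewRank_of_mul_mul_eq_one (A := Matrix.fromBlocks A 0 C B)
    (Matrix.fromBlocks X₁ 0 (-(X₂ * C * Y₁ * X₁)) X₂) (Matrix.fromBlocks Y₁ 0 0 Y₂) (by
      have h₃ : X₂ * C * Y₁ * X₁ * A * Y₁ = X₂ * C * Y₁ := by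
        rw [Matrix.mul_assoc _ X₁, Matrix.mul_assoc _ (X₁ * A), h₁, Matrix.mul_one]
      simp [Matrix.fromBlocks_multiply, h₁, h₂, h₃, Matrix.add_mul])
  simpa [hr, hs] using this

theorem skewRank_fromBlocks_diag (A : Matrix k l D) (B : Matrix m n D) :
    skewRank (Matrix.fromBlocks A 0 0 B) = skewRank A + skewRank B := by
  refine le_antisymm ?_ (add_skewRank_le_fromBlocks A 0 B)
  obtain ⟨r, C₁, E₁, -, -, hr, hA, -, -⟩ := exists_rank_factorization A
  obtain ⟨s, C₂, E₂, -, -, hs, hB, -, -⟩ := exists_rank_factorization B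
  refine (skewRank_le_card_of_eq_mul (Matrix.fromBlocks C₁ 0 0 C₂)
    (Matrix.fromBlocks E₁ 0 0 E₂) ?_).trans_eq (by simp [hr, hs])
  simp [Matrix.fromBlocks_multiply, ← hA, ← hB]

end SkewRank

/-! ### The rank algebra of square matrices over a skew field -/

section RankAlgebra

theorem comp_mul_comp {α k m n l : Type*} [Semiring α] [Fintype m] [Fintype l]
    (A : Matrix k m (Matrix l l α)) (B : Matrix m n (Matrix l l α)) :
    Matrix.comp k n l l α (A * B) = Matrix.comp k m l l α A * Matrix.comp m n l l α B := by
  ext i j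
  simp [Matrix.comp_apply, Matrix.mul_apply, Matrix.sum_apply, Fintype.sum_prod_type]

/-- The block matrix `lowerBlock A C B` over `l × l` matrices, read as a matrix over the
coefficients, is a block matrix up to a renumbering of rows and columns. -/
theorem comp_lowerBlock {α l : Type*} [Semiring α] {k p m n : ℕ}
    (A : Matrix (Fin k) (Fin p) (Matrix l l α)) (C : Matrix (Fin m) (Fin p) (Matrix l l α))
    (B : Matrix (Fin m) (Fin n) (Matrix l l α)) :
    Matrix.comp _ _ l l α (lowerBlock A C B) =
      (Matrix.fromBlocks (Matrix.comp _ _ l l α A) 0 (Matrix.comp _ _ l l α C)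
        (Matrix.comp _ _ l l α B)).submatrix
        ((finSumFinEquiv.symm.prodCongr (Equiv.refl l)).trans (Equiv.sumProdDistrib _ _ _))
        ((finSumFinEquiv.symm.prodCongr (Equiv.refl l)).trans (Equiv.sumProdDistrib _ _ _)) := by
  ext ⟨i, s⟩ ⟨j, t⟩
  obtain ⟨i, rfl⟩ := finSumFinEquiv.surjective i
  obtain ⟨j, rfl⟩ := finSumFinEquiv.surjective j
  rcases i with i | i <;> rcases j with j | j <;>
    simp [lowerBlock, Matrix.comp_apply, -finSumFinEquiv_apply_left,
      -finSumFinEquiv_apply_right]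

variable {D : Type*} [DivisionRing D] {l : ℕ}

theorem isSylvesterRank_matrixAlgebraRank (hl : 1 ≤ l) :
    IsSylvesterRank (matrixAlgebraRank D l) where
  one := by
    have : (l : ℝ) ≠ 0 := by positivity
    simp [matrixAlgebraRank, Matrix.comp_one, skewRank_one, this]
  diag A B := by
    simp only [matrixAlgebraRank, comp_lowerBlock, skewRank_submatrix_equiv, ← add_div]
    rw [← Nat.cast_add, ← skewRank_fromBlocks_diag]
    rfl
  triangular A C B := by
    simp only [matrixAlgebraRank, comp_lowerBlock, skewRank_submatrix_equiv, ← add_div]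
    have h := add_skewRank_le_fromBlocks (Matrix.comp _ _ _ _ _ A) (Matrix.comp _ _ _ _ _ C)
      (Matrix.comp _ _ _ _ _ B)
    rw [← Nat.cast_add]
    exact div_le_div_of_nonneg_right (Nat.cast_le.2 h) l.cast_nonneg
  mul A B := by
    have h₁ := skewRank_mul_le_left (Matrix.comp _ _ _ _ _ A) (Matrix.comp _ _ _ _ _ B)
    have h₂ := skewRank_mul_le_right (Matrix.comp _ _ _ _ _ A) (Matrix.comp _ _ _ _ _ B)
    rw [← comp_mul_comp] at h₁ h₂
    exact le_min (div_le_div_of_nonneg_right (Nat.cast_le.2 h₁) l.cast_nonneg)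
      (div_le_div_of_nonneg_right (Nat.cast_le.2 h₂) l.cast_nonneg)

theorem isRankAlgebra_matrixAlgebraRank (hl : 1 ≤ l) :
    IsRankAlgebra (Matrix (Fin l) (Fin l) D) (matrixAlgebraRank D l) where
  regular A := by
    obtain ⟨r, C, E, X, Y, -, hA, hX, hY⟩ := exists_rank_factorization A
    refine ⟨Y * X, ?_⟩
    calc A * (Y * X) * A = C * (E * Y) * (X * C) * E := by
          simp only [hA, Matrix.mul_assoc]
      _ = A := by rw [hX, hY, Matrix.mul_one, Matrix.mul_one, hA]
  sylvester := isSylvesterRank_matrixAlgebraRank hl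
  faithful A h := by
    have hl' : (l : ℝ) ≠ 0 := by positivity
    have h0 : skewRank (Matrix.comp _ _ (Fin l) (Fin l) D A) = 0 := by
      simpa [matrixAlgebraRank, hl'] using h
    exact (Matrix.comp _ _ _ _ _).injective (skewRank_eq_zero h0)

end RankAlgebra

/-! ### Følner sequences -/

section Foelner

variable {K D : Type*} [Field K] [DivisionRing D] [Algebra K D]

open Module Submodule

instance finite_mul (L W : Submodule K D) [Module.Finite K L] [Module.Finite K W] :
    Module.Finite K ↥(L * W) :=
  Module.Finite.iff_fg.2 ((Module.Finite.iff_fg.1 ‹_›).mul (Module.Finite.iff_fg.1 ‹_›))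

/-- Enlarging `W` by the translates `a W`, for `a` in a finite set, increases the dimension by at
most the sum of the increases caused by the single translates. -/
theorem finrank_sup_iSup_map_mulLeft_le (W : Submodule K D) [Module.Finite K W] (s : Finset D) :
    Module.Finite K ↥(W ⊔ ⨆ a ∈ s, W.map (LinearMap.mulLeft K a)) ∧
    finrank K ↥(W ⊔ ⨆ a ∈ s, W.map (LinearMap.mulLeft K a)) + s.card * finrank K W ≤
      finrank K W + ∑ a ∈ s, finrank K ↥(W ⊔ W.map (LinearMap.mulLeft K a)) := by
  classical
  induction s using Finset.induction_on with
  | empty =>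
    have h : W ⊔ ⨆ a ∈ (∅ : Finset D), W.map (LinearMap.mulLeft K a) = W := by simp
    rw [h]
    exact ⟨inferInstance, by simp⟩
  | insert a s ha ih =>
    obtain ⟨hfin, ih⟩ := ih
    set X := W ⊔ ⨆ a ∈ s, W.map (LinearMap.mulLeft K a) with hX
    have hXa : W ⊔ ⨆ b ∈ insert a s, W.map (LinearMap.mulLeft K b) =
        X ⊔ (W ⊔ W.map (LinearMap.mulLeft K a)) := by
      rw [Finset.iSup_insert, hX]
      apply le_antisymm
      · refine sup_le (le_sup_of_le_left le_sup_left) (sup_le ?_ ?_)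
        · exact le_sup_of_le_right le_sup_right
        · exact le_sup_of_le_left le_sup_right
      · exact sup_le (sup_le_sup_left le_sup_right _) (sup_le_sup_left le_sup_left _)
    rw [hXa]
    refine ⟨inferInstance, ?_⟩
    have h₁ := finrank_sup_add_finrank_inf_eq X (W ⊔ W.map (LinearMap.mulLeft K a))
    have h₂ : finrank K W ≤ finrank K ↥(X ⊓ (W ⊔ W.map (LinearMap.mulLeft K a))) :=
      Submodule.finrank_mono (le_inf le_sup_left le_sup_left)
    rw [Finset.card_insert_of_notMem ha, Finset.sum_insert ha, add_mul]
    omega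

/-- Passing from `W` to the elements `x` of `W` with `a * x ∈ W` for all `a` in a finite set
decreases the dimension by at most the sum of the increases caused by the translates `a W`. -/
theorem finrank_le_finrank_inf_iInf_comap_mulLeft (W : Submodule K D) [Module.Finite K W]
    (s : Finset D) :
    finrank K W + s.card * finrank K W ≤
      finrank K ↥(W ⊓ ⨅ a ∈ s, W.comap (LinearMap.mulLeft K a)) +
        ∑ a ∈ s, finrank K ↥(W ⊔ W.map (LinearMap.mulLeft K a)) := by
  classical
  induction s using Finset.induction_on with
  | empty =>
    have h : W ⊓ ⨅ a ∈ (∅ : Finset D), W.comap (LinearMap.mulLeft K a) = W := by simp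
    rw [h]
    simp
  | insert a s ha ih =>
    set X := W ⊓ ⨅ a ∈ s, W.comap (LinearMap.mulLeft K a) with hX
    have hXW : X ≤ W := inf_le_left
    have : Module.Finite K X := Submodule.finiteDimensional_of_le hXW
    have hXa : W ⊓ ⨅ b ∈ insert a s, W.comap (LinearMap.mulLeft K b) =
        X ⊓ W.comap (LinearMap.mulLeft K a) := by
      rw [Finset.iInf_insert, hX, inf_assoc, inf_comm (⨅ b ∈ s, _)]
    have key : finrank K X + finrank K W ≤ finrank K ↥(X ⊓ W.comap (LinearMap.mulLeft K a)) +
        finrank K ↥(W ⊔ W.map (LinearMap.mulLeft K a)) := by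
      rcases eq_or_ne a 0 with rfl | ha0
      · have h₁ : X ⊓ W.comap (LinearMap.mulLeft K (0 : D)) = X := by
          refine inf_eq_left.2 fun x _ => ?_
          simp
        rw [h₁]
        exact Nat.add_le_add_left (Submodule.finrank_mono le_sup_left) _
      · have hinj : Function.Injective (LinearMap.mulLeft K a) := fun x y h =>
          mul_left_cancel₀ ha0 h
        have h₁ := finrank_sup_add_finrank_inf_eq (X.map (LinearMap.mulLeft K a)) W
        rw [map_inf_eq_map_inf_comap] at h₁
        have h₂ := (equivMapOfInjective _ hinj X).finrank_eq
        have h₃ : finrank K ↥((X ⊓ W.comap (LinearMap.mulLeft K a)).map (LinearMap.mulLeft K a)) ≤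
            finrank K ↥(X ⊓ W.comap (LinearMap.mulLeft K a)) := Submodule.finrank_map_le _ _
        have h₄ : finrank K ↥(X.map (LinearMap.mulLeft K a) ⊔ W) ≤
            finrank K ↥(W ⊔ W.map (LinearMap.mulLeft K a)) :=
          Submodule.finrank_mono
            (sup_le (le_sup_of_le_right (Submodule.map_mono hXW)) le_sup_left)
        omega
    rw [hXa, Finset.card_insert_of_notMem ha, Finset.sum_insert ha, add_mul]
    omega


/-- A Følner sequence: finite dimensional nonzero subspaces that are almost invariant under left
multiplication by each element. -/
structure IsLeftFoelner (W : ℕ → Submodule K D) : Prop where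
  finite : ∀ n, Module.Finite K (W n)
  ne_bot : ∀ n, W n ≠ ⊥
  tendsto : ∀ a : D, Tendsto
    (fun n => (finrank K ↥(W n ⊔ (W n).map (LinearMap.mulLeft K a)) : ℝ) / finrank K (W n))
    atTop (𝓝 1)

theorem IsLeftFoelner.finrank_pos {W : ℕ → Submodule K D} (hW : IsLeftFoelner W) (n : ℕ) :
    0 < finrank K (W n) := by
  have := hW.finite n
  have := nontrivial_iff_ne_bot.2 (hW.ne_bot n)
  exact Module.finrank_pos

/-- An amenable algebra has a Følner sequence: the quotients of dimensions that converge to `1`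
cannot be the junk value `0 / 0 = 0` infinitely often. -/
theorem IsAmenableAlgebra.exists_isLeftFoelner (hD : IsAmenableAlgebra K D) :
    ∃ W : ℕ → Submodule K D, IsLeftFoelner W := by
  obtain ⟨W, hfin, hW⟩ := hD
  have h0 : ∀ᶠ n in atTop, W n ≠ ⊥ := by
    filter_upwards [(hW 0).eventually_ne one_ne_zero] with n hn h
    simp [h] at hn
  obtain ⟨N, hN⟩ := eventually_atTop.1 h0
  exact ⟨fun n => W (n + N), fun n => hfin _, fun n => hN _ (Nat.le_add_left _ _),
    fun a => (hW a).comp (tendsto_add_atTop_nat N)⟩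

variable {W : ℕ → Submodule K D}

theorem tendsto_sum_finrank_sup_div (hW : IsLeftFoelner W) (s : Finset D) :
    Tendsto (fun n => (∑ a ∈ s, (finrank K ↥(W n ⊔ (W n).map (LinearMap.mulLeft K a)) : ℝ)) /
      finrank K (W n)) atTop (𝓝 s.card) := by
  simp only [Finset.sum_div]
  simpa using tendsto_finsetSum s fun a _ => hW.tendsto a

/-- A Følner sequence is almost invariant under left multiplication by a finite dimensional
subspace. -/
theorem IsLeftFoelner.tendsto_mul [Finite K] (hW : IsLeftFoelner W) (L : Submodule K D)
    [Module.Finite K L] (h1 : 1 ∈ L) :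
    Tendsto (fun n => (finrank K ↥(L * W n) : ℝ) / finrank K (W n)) atTop (𝓝 1) := by
  have : Finite L := Module.finite_of_finite K
  set s : Finset D := (Set.toFinite (L : Set D)).toFinset with hs
  have hmem : ∀ a, a ∈ s ↔ a ∈ L := by simp [hs]
  have hle : ∀ n, W n ≤ L * W n := fun n x hx => by simpa using mul_mem_mul h1 hx
  have hbound : ∀ n, L * W n ≤ W n ⊔ ⨆ a ∈ s, (W n).map (LinearMap.mulLeft K a) := fun n => by
    refine mul_le.2 fun a ha x hx => mem_sup_right ?_
    exact mem_iSup_of_mem a (mem_iSup_of_mem ((hmem a).2 ha) ⟨x, hx, rfl⟩)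
  have hlim := (tendsto_sum_finrank_sup_div hW s).const_add (1 - s.card : ℝ)
  rw [sub_add_cancel] at hlim
  refine tendsto_of_tendsto_of_tendsto_of_le_of_le tendsto_const_nhds hlim ?_ ?_
  · intro n
    have := hW.finite n
    have hpos : (0 : ℝ) < finrank K (W n) := by exact_mod_cast hW.finrank_pos n
    have : Module.Finite K ↥(L * W n) := finite_mul _ _
    rw [le_div_iff₀ hpos, one_mul]
    exact_mod_cast Submodule.finrank_mono (hle n)
  · intro n
    have := hW.finite n
    have hpos : (0 : ℝ) < finrank K (W n) := by exact_mod_cast hW.finrank_pos n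
    obtain ⟨hfin, h⟩ := finrank_sup_iSup_map_mulLeft_le (W n) s
    have h' := Submodule.finrank_mono (hbound n)
    have h'' : (finrank K ↥(L * W n) : ℝ) + s.card * finrank K (W n) ≤
        finrank K (W n) + ∑ a ∈ s, (finrank K ↥(W n ⊔ (W n).map (LinearMap.mulLeft K a)) : ℝ) := by
      exact_mod_cast (Nat.add_le_add_right h' _).trans h
    dsimp only
    rw [div_le_iff₀ hpos, add_mul, div_mul_cancel₀ _ hpos.ne']
    linarith

/-- Most elements of the `n`-th set of a Følner sequence stay in that set under left
multiplication by all elements of a finite dimensional subspace. -/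
theorem IsLeftFoelner.eventually_finrank_core [Finite K] (hW : IsLeftFoelner W) (V : Submodule K D)
    [Module.Finite K V] {δ : ℝ} (hδ : 0 < δ) :
    ∀ᶠ n in atTop, ∃ X ≤ W n, (∀ v ∈ V, ∀ x ∈ X, v * x ∈ W n) ∧
      (1 - δ) * finrank K (W n) ≤ finrank K X := by
  have : Finite V := Module.finite_of_finite K
  set s : Finset D := (Set.toFinite (V : Set D)).toFinset with hs
  have hmem : ∀ a, a ∈ s ↔ a ∈ V := by simp [hs]
  filter_upwards [(tendsto_sum_finrank_sup_div hW s).eventually_le_const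
    (lt_add_of_pos_right (s.card : ℝ) hδ)] with n hn
  have := hW.finite n
  have hpos : (0 : ℝ) < finrank K (W n) := by exact_mod_cast hW.finrank_pos n
  refine ⟨W n ⊓ ⨅ a ∈ s, (W n).comap (LinearMap.mulLeft K a), inf_le_left, ?_, ?_⟩
  · intro v hv x hx
    exact (mem_iInf _).1 ((mem_iInf _).1 hx.2 v) ((hmem v).2 hv)
  · have h := finrank_le_finrank_inf_iInf_comap_mulLeft (W n) s
    have h' : (finrank K (W n) : ℝ) + s.card * finrank K (W n) ≤
        finrank K ↥(W n ⊓ ⨅ a ∈ s, (W n).comap (LinearMap.mulLeft K a)) +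
          ∑ a ∈ s, (finrank K ↥(W n ⊔ (W n).map (LinearMap.mulLeft K a)) : ℝ) := by
      exact_mod_cast h
    rw [div_le_iff₀ hpos] at hn
    linarith

theorem isLeftFoelner_top [Module.Finite K D] : IsLeftFoelner fun _ : ℕ => (⊤ : Submodule K D) where
  finite _ := inferInstance
  ne_bot _ := top_ne_bot
  tendsto a := by
    have h : (finrank K D : ℝ) ≠ 0 := by exact_mod_cast Module.finrank_pos.ne'
    rw [top_sup_eq, finrank_top, div_self h]
    exact tendsto_const_nhds

/-- In an infinite dimensional division algebra, the dimensions along a Følner sequence tend to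
infinity: a Følner set `W` of dimension at most `C` that is almost invariant under `C + 1` linearly
independent elements `a` is invariant under them, and contains the elements `a * w`, for a nonzero
element `w`, which are linearly independent. -/
theorem IsLeftFoelner.tendsto_finrank (hW : IsLeftFoelner W) (hD : ¬ Module.Finite K D) :
    Tendsto (fun n => finrank K (W n)) atTop atTop := by
  refine tendsto_atTop.2 fun C => ?_
  obtain ⟨a, ha⟩ : ∃ a : Fin (C + 1) → D, LinearIndependent K a := by
    refine exists_linearIndependent_of_le_rank (Cardinal.natCast_lt_aleph0.le.trans ?_)
    exact not_lt.1 fun h => hD (Module.rank_lt_aleph0_iff.1 h)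
  have hδ : (1 : ℝ) < 1 + 1 / (C + 1) := by
    have : (0 : ℝ) < 1 / (C + 1) := by positivity
    linarith
  filter_upwards [eventually_all.2 fun i => (hW.tendsto (a i)).eventually_lt_const hδ] with n hn
  by_contra! hC
  have := hW.finite n
  have hpos : (0 : ℝ) < finrank K (W n) := by exact_mod_cast hW.finrank_pos n
  obtain ⟨w, hw, hw0⟩ := (W n).ne_bot_iff.1 (hW.ne_bot n)
  have hinv : ∀ i, a i * w ∈ W n := fun i => by
    have h : finrank K ↥(W n ⊔ (W n).map (LinearMap.mulLeft K (a i))) < finrank K (W n) + 1 := by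
      have h₁ := hn i
      rw [div_lt_iff₀ hpos, add_mul, one_mul, div_mul_eq_mul_div, one_mul] at h₁
      have h₂ : (finrank K (W n) : ℝ) / (C + 1) < 1 := by
        rw [div_lt_one (by positivity)]
        exact_mod_cast hC.trans (Nat.lt_succ_self C)
      exact_mod_cast h₁.trans (add_lt_add_right h₂ _)
    have h' := Submodule.eq_of_le_of_finrank_le
      (le_sup_left : W n ≤ W n ⊔ (W n).map (LinearMap.mulLeft K (a i))) (by omega)
    rw [h']
    exact mem_sup_right ⟨w, hw, rfl⟩
  have hli : LinearIndependent K fun i => (⟨a i * w, hinv i⟩ : W n) := by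
    refine LinearIndependent.of_comp (W n).subtype ?_
    exact ha.map' (LinearMap.mulRight K w)
      (LinearMap.ker_eq_bot.2 fun x y h => mul_right_cancel₀ hw0 h)
  have := hli.fintype_card_le_finrank
  simp at this
  omega

end Foelner

/-! ### Images of almost invariant subspaces under matrices -/

section RankEstimate

open Module Submodule

theorem finrank_map_add_finrank_le {K V V' : Type*} [Field K] [AddCommGroup V] [Module K V]
    [AddCommGroup V'] [Module K V'] (f : V →ₗ[K] V') {U U' : Submodule K V} (h : U ≤ U')
    [Module.Finite K U'] :
    finrank K (U'.map f) + finrank K U ≤ finrank K (U.map f) + finrank K U' := by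
  have : Module.Finite K U := Submodule.finiteDimensional_of_le h
  have h₁ := (f.domRestrict U).finrank_range_add_finrank_ker
  have h₂ := (f.domRestrict U').finrank_range_add_finrank_ker
  rw [LinearMap.range_domRestrict] at h₁ h₂
  have h₃ : finrank K (LinearMap.ker (f.domRestrict U)) ≤
      finrank K (LinearMap.ker (f.domRestrict U')) := by
    refine LinearMap.finrank_le_finrank_of_injective
      (f := (inclusion h).restrict (p := LinearMap.ker (f.domRestrict U))
        (q := LinearMap.ker (f.domRestrict U')) fun x hx => by simpa using hx) ?_
    intro x y hxy
    exact Subtype.ext (inclusion_injective h (congrArg Subtype.val hxy))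
  omega

variable {K D : Type*} [Field K] [DivisionRing D] [Algebra K D]

/-- The `K`-subspace of vectors with all coordinates in `W`. -/
abbrev box (W : Submodule K D) (n : Type*) : Submodule K (n → D) :=
  Submodule.pi Set.univ fun _ => W

theorem box_eq_range (W : Submodule K D) (n : Type*) :
    box W n = LinearMap.range (W.subtype.compLeft n) := by
  ext v
  constructor
  · exact fun h => ⟨fun i => ⟨v i, h i trivial⟩, rfl⟩
  · rintro ⟨w, rfl⟩ i -
    exact (w i).2

instance finite_box (W : Submodule K D) [Module.Finite K W] (n : Type*) [Finite n] :
    Module.Finite K (box W n) := by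
  rw [box_eq_range]
  infer_instance

theorem finrank_box (W : Submodule K D) [Module.Finite K W] (n : Type*) [Fintype n] :
    finrank K (box W n) = Fintype.card n * finrank K W := by
  rw [box_eq_range, LinearMap.finrank_range_of_inj
    (fun v w h => funext fun i => Subtype.ext (congrFun h i)), finrank_pi_fintype]
  simp

theorem box_mono {W W' : Submodule K D} (h : W ≤ W') (n : Type*) : box W n ≤ box W' n :=
  fun _ hv i hi => h (hv i hi)

/-- Left multiplication of column vectors by a matrix, as a `K`-linear map. -/
abbrev mulVecK (K : Type*) {D m n : Type*} [Field K] [DivisionRing D] [Algebra K D] [Fintype n]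
    (B : Matrix m n D) : (n → D) →ₗ[K] (m → D) :=
  Matrix.mulVecBilin K K B

theorem map_mulVecK_box_le {m n : Type*} [Fintype n] {L : Submodule K D} (B : Matrix m n D)
    (hB : ∀ i j, B i j ∈ L) (W : Submodule K D) :
    (box W n).map (mulVecK K B) ≤ box (L * W) m := by
  rintro _ ⟨v, hv, rfl⟩ i -
  exact sum_mem fun j _ => mul_mem_mul (hB i j) (hv j trivial)

/-- If `T` lies between the subspaces `W^n` and `(L₀ W)^n` of `D^n`, and `W` is almost invariant
under left multiplication by a finite dimensional subspace `L` that depends only on the matrix `B`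
and on `L₀`, then the dimension of `B T` is about `rank B` times the dimension of `W`. The space
`L` is chosen by means of a rank factorization `B = C * E`, `X * C = 1`, `E * Y = 1`: the upper bound
comes from `B T = C (E T)`, the lower bound from `X B Y W^r = W^r`. -/
theorem exists_finrank_map_mulVecK_bounds {m n : Type*} [Fintype m] [Fintype n]
    (B : Matrix m n D) (L₀ : Submodule K D) [Module.Finite K L₀] :
    ∃ L : Submodule K D, Module.Finite K L ∧ 1 ∈ L ∧
      ∀ (W : Submodule K D) [Module.Finite K W] (T : Submodule K (n → D)),
        box W n ≤ T → T ≤ box (L₀ * W) n →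
        skewRank B * finrank K W + Fintype.card n * finrank K W ≤
            finrank K (T.map (mulVecK K B)) + Fintype.card n * finrank K ↥(L * W) ∧
          finrank K (T.map (mulVecK K B)) ≤ skewRank B * finrank K ↥(L * W) := by
  classical
  obtain ⟨r, C, E, X, Y, hr, hB, hX, hY⟩ := exists_rank_factorization B
  set S : Set D := {1} ∪ ((Set.range fun p : m × Fin r => C p.1 p.2) ∪
    ((Set.range fun p : Fin r × n => E p.1 p.2) ∪ Set.range fun p : n × Fin r => Y p.1 p.2))
    with hS
  have hSfin : S.Finite := (Set.finite_singleton _).union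
    ((Set.finite_range _).union ((Set.finite_range _).union (Set.finite_range _)))
  have := Module.Finite.span_of_finite K hSfin
  set L₁ : Submodule K D := L₀ ⊔ span K S with hL₁
  have hSL : ∀ x ∈ S, x ∈ L₁ := fun x hx => mem_sup_right (subset_span hx)
  have h1 : (1 : D) ∈ L₁ := hSL _ (by simp [hS])
  have hC : ∀ i j, C i j ∈ L₁ := fun i j => hSL _ (.inr (.inl ⟨(i, j), rfl⟩))
  have hE : ∀ i j, E i j ∈ L₁ := fun i j => hSL _ (.inr (.inr (.inl ⟨(i, j), rfl⟩)))
  have hY' : ∀ i j, Y i j ∈ L₁ := fun i j => hSL _ (.inr (.inr (.inr ⟨(i, j), rfl⟩)))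
  have hLL : L₁ ≤ L₁ * L₁ := fun x hx => by simpa using mul_mem_mul h1 hx
  refine ⟨L₁ * L₁, inferInstance, hLL h1, fun W _ T hWT hTW => ?_⟩
  rw [hr]
  have hTW' : T ≤ box (L₁ * W) n :=
    hTW.trans (box_mono (mul_le_mul_left le_sup_left _) n)
  have : Module.Finite K T := Submodule.finiteDimensional_of_le hTW'
  constructor
  · have hWL : box W n ≤ box (L₁ * W) n := box_mono (fun x hx => by simpa using mul_mem_mul h1 hx) n
    have h₁ := finrank_map_add_finrank_le (mulVecK K B) hWL
    rw [finrank_box, finrank_box] at h₁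
    have h₂ : r * finrank K W ≤ finrank K ((box (L₁ * W) n).map (mulVecK K B)) := by
      have hle : box W (Fin r) ≤ ((box (L₁ * W) n).map (mulVecK K B)).map (mulVecK K X) := by
        intro v hv
        refine ⟨_, ⟨_, map_mulVecK_box_le Y hY' W ⟨v, hv, rfl⟩, rfl⟩, ?_⟩
        simp only [Matrix.mulVecBilin_apply, Matrix.mulVec_mulVec]
        have : X * B * Y = 1 := by
          rw [hB, ← Matrix.mul_assoc, hX, Matrix.one_mul, hY]
        rw [← Matrix.mul_assoc, this, Matrix.one_mulVec]
      calc r * finrank K W = finrank K (box W (Fin r)) := by simp [finrank_box]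
        _ ≤ _ := Submodule.finrank_mono hle
        _ ≤ _ := Submodule.finrank_map_le _ _
    have h₃ : finrank K ((box W n).map (mulVecK K B)) ≤ finrank K (T.map (mulVecK K B)) :=
      Submodule.finrank_mono (Submodule.map_mono hWT)
    have h₄ : finrank K ↥(L₁ * W) ≤ finrank K ↥(L₁ * L₁ * W) :=
      Submodule.finrank_mono (mul_le_mul_left hLL _)
    have h₅ := Nat.mul_le_mul_left (Fintype.card n) h₄
    omega
  · have hle : T.map (mulVecK K B) ≤ (box (L₁ * (L₁ * W)) (Fin r)).map (mulVecK K C) := by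
      rintro _ ⟨v, hv, rfl⟩
      refine ⟨_, map_mulVecK_box_le E hE _ ⟨v, hTW' hv, rfl⟩, ?_⟩
      simp only [Matrix.mulVecBilin_apply, Matrix.mulVec_mulVec, ← hB]
    calc _ ≤ _ := Submodule.finrank_mono hle
      _ ≤ finrank K (box (L₁ * (L₁ * W)) (Fin r)) := Submodule.finrank_map_le _ _
      _ = _ := by rw [finrank_box, Fintype.card_fin, mul_assoc]

end RankEstimate

/-! ### Submodules of the column space -/

section Model

open Module

variable {K : Type uK} {R : Type uR} {D : Type uS} [Field K] [Ring R] [Algebra K R]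
  [DivisionRing D] [Algebra K D] {l : ℕ}

/-- The column space `D^l`, as an `R`-module through a representation of `R` by matrices. -/
def RepSpace (_ρ : R →ₐ[K] Matrix (Fin l) (Fin l) D) : Type uS := Fin l → D

instance (ρ : R →ₐ[K] Matrix (Fin l) (Fin l) D) : AddCommGroup (RepSpace ρ) :=
  inferInstanceAs (AddCommGroup (Fin l → D))

instance (ρ : R →ₐ[K] Matrix (Fin l) (Fin l) D) : Module K (RepSpace ρ) :=
  inferInstanceAs (Module K (Fin l → D))

instance (ρ : R →ₐ[K] Matrix (Fin l) (Fin l) D) : Module R (RepSpace ρ) where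
  smul r v := (ρ r).mulVec v
  one_smul v := (congrArg (Matrix.mulVec · v) (map_one ρ)).trans (Matrix.one_mulVec (m := Fin l) v)
  mul_smul r s v := (congrArg (Matrix.mulVec · v) (map_mul ρ r s)).trans
    (Matrix.mulVec_mulVec v _ _).symm
  smul_zero _ := Matrix.mulVec_zero _
  smul_add _ _ _ := Matrix.mulVec_add _ _ _
  add_smul r s v := (congrArg (Matrix.mulVec · v) (map_add ρ r s)).trans (Matrix.add_mulVec _ _ _)
  zero_smul v := (congrArg (Matrix.mulVec · v) (map_zero ρ)).trans (Matrix.zero_mulVec v)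

instance (ρ : R →ₐ[K] Matrix (Fin l) (Fin l) D) : IsScalarTower K R (RepSpace ρ) where
  smul_assoc c r v := (congrArg (Matrix.mulVec · v) (map_smul ρ c r)).trans
    (Matrix.smul_mulVec c (ρ r) v)

/-- A finitely generated module, in whatever universe it lives, is isomorphic to a quotient of a
finite free module, hence to one in the universe of the ring. -/
theorem exists_finMod_equiv (M : Type*) [AddCommGroup M] [Module R M] [Module.Finite R M] :
    ∃ M' : FinMod K R, Nonempty (M' ≃ₗ[R] M) := by
  obtain ⟨n, f, hf⟩ := Module.Finite.exists_fin' R M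
  exact ⟨⟨(Fin n → R) ⧸ LinearMap.ker f⟩, ⟨f.quotKerEquivOfSurjective hf⟩⟩

/-- The span of all entries of the matrices that represent elements of `R`. -/
def entrySpan (ρ : R →ₐ[K] Matrix (Fin l) (Fin l) D) : Submodule K D :=
  Submodule.span K (Set.range fun p : R × Fin l × Fin l => ρ p.1 p.2.1 p.2.2)

theorem apply_mem_entrySpan (ρ : R →ₐ[K] Matrix (Fin l) (Fin l) D) (r : R) (i j : Fin l) :
    ρ r i j ∈ entrySpan ρ :=
  Submodule.subset_span ⟨(r, i, j), rfl⟩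

theorem finite_entrySpan [Finite R] (ρ : R →ₐ[K] Matrix (Fin l) (Fin l) D) :
    Module.Finite K (entrySpan ρ) :=
  Module.Finite.span_of_finite K (Set.finite_range _)

theorem one_mem_entrySpan (hl : 1 ≤ l) (ρ : R →ₐ[K] Matrix (Fin l) (Fin l) D) :
    1 ∈ entrySpan ρ := by
  simpa using apply_mem_entrySpan ρ 1 ⟨0, hl⟩ ⟨0, hl⟩

/-- An embedding `φ` of the `R`-module `M` into `D^l` such that the image of `M` lies between
`W^l` and `(L W)^l`, where `L` is the span of the entries of the matrices `ρ r`. -/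
structure IsModel (ρ : R →ₐ[K] Matrix (Fin l) (Fin l) D) (W : Submodule K D) (M : FinMod K R)
    (φ : M →ₗ[K] (Fin l → D)) : Prop where
  injective : Function.Injective φ
  map_smul : ∀ (r : R) (x : M), φ (r • x) = (ρ r).mulVec (φ x)
  box_le : box W (Fin l) ≤ LinearMap.range φ
  le_box : LinearMap.range φ ≤ box (entrySpan ρ * W) (Fin l)

/-- The `R`-submodule of `D^l` generated by `W^l` is a model. -/
theorem exists_isModel [Finite K] (ρ : R →ₐ[K] Matrix (Fin l) (Fin l) D) (W : Submodule K D)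
    [Module.Finite K W] :
    ∃ (M : FinMod K R) (φ : M →ₗ[K] (Fin l → D)), IsModel ρ W M φ := by
  set S : Set (RepSpace ρ) := (box W (Fin l) : Set (Fin l → D)) with hS
  have hSfin : S.Finite := by
    have : Finite (box W (Fin l)) := Module.finite_of_finite K
    exact Set.toFinite (box W (Fin l) : Set (Fin l → D))
  have : Module.Finite R (Submodule.span R S) := Module.Finite.span_of_finite R hSfin
  obtain ⟨M, ⟨e⟩⟩ := exists_finMod_equiv (K := K) (R := R) (Submodule.span R S)
  let ψ : M →ₗ[R] RepSpace ρ := (Submodule.span R S).subtype ∘ₗ e.toLinearMap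
  have hψ : ∀ v : RepSpace ρ, v ∈ Submodule.span R S → ∃ x, ψ x = v := fun v hv =>
    ⟨e.symm ⟨v, hv⟩, by simp [ψ]⟩
  refine ⟨M, ψ.restrictScalars K, ?_, ?_, ?_, ?_⟩
  · exact Subtype.val_injective.comp e.injective
  · exact fun r x => ψ.map_smul r x
  · exact fun v hv => hψ v (Submodule.subset_span hv)
  · rintro _ ⟨x, rfl⟩
    have hx : ψ x ∈ Submodule.span R S := (e x).2
    change (show Fin l → D from ψ x) ∈ _
    generalize ψ x = v at hx ⊢
    induction hx using Submodule.closure_induction with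
    | zero => exact zero_mem _
    | add v w _ _ hv hw => exact add_mem hv hw
    | smul_mem r v hv =>
      exact map_mulVecK_box_le (ρ r) (apply_mem_entrySpan ρ r) W ⟨v, hv, rfl⟩

end Model

/-! ### Convergence of the rank functions -/

section ModelRank

open Module

variable {K : Type uK} {R : Type uR} {D : Type uS} [Field K] [Ring R] [Algebra K R]
  [DivisionRing D] [Algebra K D] {l : ℕ} {ρ : R →ₐ[K] Matrix (Fin l) (Fin l) D}

theorem IsModel.finite {W : Submodule K D} [Module.Finite K W] {M : FinMod K R}
    {φ : M →ₗ[K] (Fin l → D)} [Module.Finite K (entrySpan ρ)] (h : IsModel ρ W M φ) :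
    Module.Finite K M := by
  have : Module.Finite K (LinearMap.range φ) := Submodule.finiteDimensional_of_le h.le_box
  exact Module.Finite.of_injective φ.rangeRestrict fun x y hxy =>
    h.injective (congrArg Subtype.val hxy)

theorem IsModel.le_finrank {W : Submodule K D} [Module.Finite K W] {M : FinMod K R}
    {φ : M →ₗ[K] (Fin l → D)} [Module.Finite K (entrySpan ρ)] (h : IsModel ρ W M φ) :
    l * finrank K W ≤ finrank K M ∧ finrank K M ≤ l * finrank K ↥(entrySpan ρ * W) := by
  have : Module.Finite K (LinearMap.range φ) := Submodule.finiteDimensional_of_le h.le_box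
  rw [← LinearMap.finrank_range_of_inj h.injective]
  constructor
  · simpa [finrank_box] using Submodule.finrank_mono h.box_le
  · simpa [finrank_box] using Submodule.finrank_mono h.le_box

/-- The action of matrices over `R` on a model, expressed inside `D^(m * l)`. -/
theorem IsModel.exists_finrank_range_matrixAction {W : Submodule K D} {M : FinMod K R}
    {φ : M →ₗ[K] (Fin l → D)} (h : IsModel ρ W M φ) (m : ℕ) :
    ∃ T : Submodule K (Fin m × Fin l → D), box W (Fin m × Fin l) ≤ T ∧
      T ≤ box (entrySpan ρ * W) (Fin m × Fin l) ∧
      ∀ (k : ℕ) (A : Matrix (Fin k) (Fin m) R),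
        finrank K (LinearMap.range (matrixAction M A)) =
          finrank K (T.map (mulVecK K (Matrix.comp _ _ _ _ D (A.map ρ)))) := by
  let Φ : ∀ n : ℕ, (Fin n → M) →ₗ[K] (Fin n × Fin l → D) := fun n =>
    { toFun := fun v p => φ (v p.1) p.2
      map_add' := fun v w => by ext; simp
      map_smul' := fun c v => by ext; simp }
  have hΦ : ∀ n, Function.Injective (Φ n) := fun n v w hvw =>
    funext fun i => h.injective (funext fun j => congrFun hvw (i, j))
  refine ⟨LinearMap.range (Φ m), ?_, ?_, fun k A => ?_⟩
  · intro v hv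
    have hv' : ∀ i, ∃ x, φ x = fun j => v (i, j) := fun i =>
      h.box_le (x := fun j => v (i, j)) fun j _ => hv (i, j) trivial
    choose x hx using hv'
    exact ⟨x, funext fun p => congrFun (hx p.1) p.2⟩
  · rintro _ ⟨v, rfl⟩ p -
    exact h.le_box ⟨v p.1, rfl⟩ p.2 trivial
  · have hcomm : Φ k ∘ₗ matrixAction M A =
        mulVecK K (Matrix.comp _ _ _ _ D (A.map ρ)) ∘ₗ Φ m := by
      ext v p
      simp only [LinearMap.comp_apply, matrixAction, LinearMap.coe_mk, AddHom.coe_mk, Φ, map_sum,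
        h.map_smul, Finset.sum_apply, Matrix.mulVecBilin_apply, Matrix.mulVec, dotProduct,
        Fintype.sum_prod_type, Matrix.comp_apply, Matrix.map_apply]
    rw [← LinearMap.range_comp, ← hcomm, LinearMap.range_comp]
    exact (Submodule.equivMapOfInjective _ (hΦ k) _).finrank_eq

theorem tendsto_rankOfMod [Finite K] (hl : 1 ≤ l) [Module.Finite K (entrySpan ρ)]
    {W : ℕ → Submodule K D} (hW : IsLeftFoelner W) {M : ℕ → FinMod K R}
    {φ : ∀ n, M n →ₗ[K] (Fin l → D)} (h : ∀ n, IsModel ρ (W n) (M n) (φ n)) (k m : ℕ)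
    (A : Matrix (Fin k) (Fin m) R) :
    Tendsto (fun n => rankOfMod (M n) k m A) atTop
      (𝓝 (rankOfRep (matrixAlgebraRank D l) ρ k m A)) := by
  set B := Matrix.comp _ _ _ _ D (A.map ρ) with hB
  obtain ⟨L, hLfin, h1, hL⟩ := exists_finrank_map_mulVecK_bounds B (entrySpan ρ)
  have hLlim := hW.tendsto_mul L h1
  have hE := hW.tendsto_mul (entrySpan ρ) (one_mem_entrySpan hl ρ)
  have hl0 : (l : ℝ) ≠ 0 := by positivity
  have hpos : ∀ n, (0 : ℝ) < finrank K (W n) := fun n => by exact_mod_cast hW.finrank_pos n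
  -- after division by the dimension of `W n`, the dimension of the image tends to the rank of `B`
  have hnum : Tendsto (fun n => (finrank K (LinearMap.range (matrixAction (M n) A)) : ℝ) /
      finrank K (W n)) atTop (𝓝 (skewRank B)) := by
    set p := Fintype.card (Fin m × Fin l)
    have hlow := (hLlim.const_mul (p : ℝ)).const_sub ((skewRank B : ℝ) + p)
    have hup := hLlim.const_mul (skewRank B : ℝ)
    rw [mul_one, add_sub_cancel_right] at hlow
    rw [mul_one] at hup
    have key : ∀ n, (skewRank B : ℝ) * finrank K (W n) + p * finrank K (W n) ≤
          finrank K (LinearMap.range (matrixAction (M n) A)) + p * finrank K ↥(L * W n) ∧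
        (finrank K (LinearMap.range (matrixAction (M n) A)) : ℝ) ≤
          skewRank B * finrank K ↥(L * W n) := fun n => by
      have := hW.finite n
      obtain ⟨T, hT₁, hT₂, hT⟩ := (h n).exists_finrank_range_matrixAction m
      rw [hT k A]
      exact_mod_cast hL (W n) T hT₁ hT₂
    refine tendsto_of_tendsto_of_tendsto_of_le_of_le hlow hup (fun n => ?_) fun n => ?_
    · dsimp only
      rw [le_div_iff₀ (hpos n), sub_mul, mul_assoc, div_mul_cancel₀ _ (hpos n).ne']
      linarith [(key n).1]
    · dsimp only
      rw [← mul_div_assoc]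
      exact div_le_div_of_nonneg_right (key n).2 (hpos n).le
  have hden : Tendsto (fun n => (finrank K (M n) : ℝ) / finrank K (W n)) atTop (𝓝 l) := by
    have hup := hE.const_mul (l : ℝ)
    rw [mul_one] at hup
    have key : ∀ n, (l : ℝ) * finrank K (W n) ≤ finrank K (M n) ∧
        (finrank K (M n) : ℝ) ≤ l * finrank K ↥(entrySpan ρ * W n) := fun n => by
      have := hW.finite n
      exact_mod_cast (h n).le_finrank
    refine tendsto_of_tendsto_of_tendsto_of_le_of_le tendsto_const_nhds hup (fun n => ?_)
      fun n => ?_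
    · dsimp only
      rw [le_div_iff₀ (hpos n)]
      exact (key n).1
    · dsimp only
      rw [← mul_div_assoc]
      exact div_le_div_of_nonneg_right (key n).2 (hpos n).le
  refine (hnum.div hden hl0).congr fun n => ?_
  exact div_div_div_cancel_right₀ (hpos n).ne' _ _

end ModelRank

/-! ### Tilings and hyperfiniteness -/

section Tiling

open Module

variable {K : Type uK} {R : Type uR} {D : Type uS} [Field K] [Ring R] [Algebra K R]
  [DivisionRing D] [Algebra K D] {l : ℕ} {ρ : R →ₐ[K] Matrix (Fin l) (Fin l) D}

/-- Over a finite field, a finite dimensional subspace `X` of `D` contains elements `x` whose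
translates `V x` are independent and which are so numerous that their total dimension falls short
of that of `X` by at most the dimension of `V`. A family of `t` such elements can be
extended, unless every `y ∈ X` solves an equation `v * y = ∑ i, w i * x i` with `v ≠ 0` and all `w i`
in `V`, and there are at most `|V| ^ (t + 1)` solutions of such equations. -/
theorem exists_independent_translates [Finite K] (V X : Submodule K D) [Module.Finite K V]
    [Module.Finite K X] (hV : V ≠ ⊥) :
    ∃ (t : ℕ) (x : Fin t → D), (∀ i, x i ∈ X) ∧
      (∀ v : Fin t → D, (∀ i, v i ∈ V) → ∑ i, v i * x i = 0 → v = 0) ∧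
      finrank K X ≤ (t + 1) * finrank K V := by
  by_contra! hcon
  have hall : ∀ t : ℕ, ∃ x : Fin t → D, (∀ i, x i ∈ X) ∧
      (∀ v : Fin t → D, (∀ i, v i ∈ V) → ∑ i, v i * x i = 0 → v = 0) := by
    intro t
    induction t with
    | zero => exact ⟨Fin.elim0, fun i => i.elim0, fun v _ _ => Subsingleton.elim _ _⟩
    | succ t ih =>
      obtain ⟨x, hxX, hx⟩ := ih
      have hlt := hcon t x hxX hx
      obtain ⟨y, hyX, hy⟩ : ∃ y ∈ X, ∀ v ∈ V, v ≠ 0 → ∀ w : Fin t → V,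
          v * y ≠ ∑ i, (w i : D) * x i := by
        by_contra! hbad
        choose v hv hv0 w hw using hbad
        have hinj : Function.Injective fun y : X =>
            ((⟨v y y.2, hv y y.2⟩, w y y.2) : V × (Fin t → V)) := by
          intro y y' hyy
          simp only [Prod.mk.injEq, Subtype.mk.injEq] at hyy
          have h₁ := hw y y.2
          rw [hyy.2, hyy.1, ← hw y' y'.2] at h₁
          exact Subtype.ext (mul_left_cancel₀ (hv0 y' y'.2) h₁)
        have : Finite V := Module.finite_of_finite K
        have hcard := Nat.card_le_card_of_injective _ hinj
        rw [Module.natCard_eq_pow_finrank (K := K), Module.natCard_eq_pow_finrank (K := K)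
          (V := V × (Fin t → V)), Nat.pow_le_pow_iff_right Finite.one_lt_card] at hcard
        rw [finrank_prod, finrank_pi_fintype] at hcard
        simp only [Finset.sum_const, Finset.card_univ, Fintype.card_fin, smul_eq_mul] at hcard
        linarith
      refine ⟨Fin.cons y x, Fin.cases hyX hxX, fun v hv hsum => ?_⟩
      rw [Fin.sum_univ_succ] at hsum
      simp only [Fin.cons_zero, Fin.cons_succ] at hsum
      have h0 : v 0 = 0 := by
        by_contra hne
        refine hy (v 0) (hv 0) hne (fun i => ⟨-v i.succ, neg_mem (hv _)⟩) ?_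
        simpa using eq_neg_of_add_eq_zero_left hsum
      rw [h0, zero_mul, zero_add] at hsum
      have htail := hx (fun i => v i.succ) (fun i => hv _) hsum
      funext i
      exact Fin.cases h0 (fun i => congrFun htail i) i
  obtain ⟨x, hxX, hx⟩ := hall (finrank K X)
  have := Submodule.nontrivial_iff_ne_bot.2 hV
  have h₁ := hcon _ x hxX hx
  have h₂ : 0 < finrank K V := Module.finrank_pos
  nlinarith

/-- Let `L` be the span of the entries of the matrices `ρ r`. If the right translates of `L * W` by
elements `x i` lie in `W'` and are independent, then a model of `W'` contains the direct sum of the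
right translates of a model `N` of `W` by the `x i`, each of which is a copy of `N`. -/
theorem IsModel.exists_submodule_equiv {W W' : Submodule K D} {N M : FinMod K R}
    {φ : N →ₗ[K] (Fin l → D)} {ψ : M →ₗ[K] (Fin l → D)} (hN : IsModel ρ W N φ)
    (hM : IsModel ρ W' M ψ) {t : ℕ} (x : Fin t → D)
    (hx : ∀ i, ∀ v ∈ entrySpan ρ * W, v * x i ∈ W')
    (hind : ∀ v : Fin t → D, (∀ i, v i ∈ entrySpan ρ * W) → ∑ i, v i * x i = 0 → v = 0) :
    ∃ P : Submodule R M, Nonempty (P ≃ₗ[R] (Fin t → N)) := by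
  have hmem : ∀ (y : N) (j : Fin l), φ y j ∈ entrySpan ρ * W := fun y j =>
    hN.le_box ⟨y, rfl⟩ j trivial
  have hex : ∀ w : Fin t → N, ∃ z : M, ψ z = fun j => ∑ i, φ (w i) j * x i := fun w =>
    hM.box_le (x := fun j => ∑ i, φ (w i) j * x i) fun j _ =>
      sum_mem fun i _ => hx i _ (hmem (w i) j)
  choose θ hθ using hex
  let Θ : (Fin t → N) →ₗ[R] M :=
    { toFun := θ
      map_add' := fun v w => hM.injective <| by
        rw [map_add, hθ, hθ, hθ]
        funext j
        simp [add_mul, Finset.sum_add_distrib]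
      map_smul' := fun r w => hM.injective <| by
        rw [RingHom.id_apply, hM.map_smul, hθ, hθ]
        funext j
        simp only [Pi.smul_apply, hN.map_smul, Matrix.mulVec, dotProduct, Finset.sum_mul,
          Finset.mul_sum, mul_assoc]
        exact Finset.sum_comm }
  have hΘ : Function.Injective Θ := by
    rw [← LinearMap.ker_eq_bot, LinearMap.ker_eq_bot']
    intro w hw
    have h0 : (fun j => ∑ i, φ (w i) j * x i) = 0 := by
      rw [← hθ w]
      change ψ (Θ w) = 0
      rw [hw, map_zero]
    funext i
    refine hN.injective ?_
    rw [Pi.zero_apply, map_zero]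
    funext j
    exact congrFun (hind (fun i => φ (w i) j) (fun i => hmem _ _) (congrFun h0 j)) i
  exact ⟨LinearMap.range Θ, ⟨(LinearEquiv.ofInjective Θ hΘ).symm⟩⟩

/-- For a sequence to be hyperfinite it is enough that, for each `ε`, all but finitely many of its
terms contain a large direct sum of copies of one module: the remaining terms can be included in
the finite family themselves. -/
theorem isHyperfinite_of_eventually (M : ℕ → FinMod K R)
    (h : ∀ ε : ℝ, 0 < ε → ∃ N : FinMod K R, ∀ᶠ n in atTop, ∃ P : Submodule R (M n),
      (1 - ε) * finrank K (M n) ≤ finrank K P ∧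
        ∃ t : ℕ, Nonempty (P ≃ₗ[R] (Fin t → N))) :
    IsHyperfinite M := by
  intro ε hε
  obtain ⟨N, hN⟩ := h ε hε
  obtain ⟨n₀, hn₀⟩ := eventually_atTop.1 hN
  let F : Fin (n₀ + 1) → FinMod K R := fun i => if (i : ℕ) = n₀ then N else M i
  -- a power of one member of the family is a direct sum of powers of all members
  have hF : ∀ (i₀ : Fin (n₀ + 1)) (t : ℕ), ∃ α : Fin (n₀ + 1) → ℕ,
      Nonempty ((Fin t → F i₀) ≃ₗ[R] ((i : Fin (n₀ + 1)) → Fin (α i) → F i)) := by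
    intro i₀ t
    refine ⟨fun i => if i = i₀ then t else 0, ⟨?_⟩⟩
    have hα : (if i₀ = i₀ then t else 0) = t := if_pos rfl
    refine (LinearEquiv.funCongrLeft R (F i₀) (finCongr hα)).trans (LinearEquiv.ofBijective
      (LinearMap.proj (R := R) (φ := fun i => Fin (if i = i₀ then t else 0) → F i) i₀)
      ⟨fun v w hvw => ?_, LinearMap.proj_surjective i₀⟩).symm
    funext i
    by_cases hi : i = i₀
    · subst hi
      exact hvw
    · have : IsEmpty (Fin (if i = i₀ then t else 0)) := by
        rw [if_neg hi]
        infer_instance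
      exact Subsingleton.elim _ _
  refine ⟨n₀ + 1, F, fun n => ?_⟩
  rcases lt_or_ge n n₀ with hn | hn
  · refine ⟨⊤, ?_, ?_⟩
    · have htop : finrank K (⊤ : Submodule R (M n)) = finrank K (M n) :=
        ((Submodule.topEquiv (R := R) (M := M n)).restrictScalars K).finrank_eq
      rw [htop]
      exact mul_le_of_le_one_left (Nat.cast_nonneg _) (by linarith)
    · obtain ⟨α, ⟨e⟩⟩ := hF ⟨n, by omega⟩ 1
      have hFn : F ⟨n, by omega⟩ = M n := if_neg hn.ne
      rw [hFn] at e
      exact ⟨α, ⟨(Submodule.topEquiv.trans (LinearEquiv.funUnique (Fin 1) R (M n)).symm).trans e⟩⟩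
  · obtain ⟨P, hP, t, ⟨e⟩⟩ := hn₀ n hn
    obtain ⟨α, ⟨e'⟩⟩ := hF (Fin.last n₀) t
    have hFn : F (Fin.last n₀) = N := if_pos rfl
    rw [hFn] at e'
    exact ⟨P, hP, α, ⟨e.trans e'⟩⟩

/-- Models of the members of a Følner sequence form a hyperfinite sequence: for each `ε`, a single
model `N` of a sufficiently invariant `W m` serves all sufficiently large `n`. -/
theorem IsLeftFoelner.isHyperfinite [Finite K] (hl : 1 ≤ l) [Module.Finite K (entrySpan ρ)]
    {W : ℕ → Submodule K D} (hW : IsLeftFoelner W)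
    (hdim : Tendsto (fun n => finrank K (W n)) atTop atTop) {M : ℕ → FinMod K R}
    {φ : ∀ n, M n →ₗ[K] (Fin l → D)} (hM : ∀ n, IsModel ρ (W n) (M n) (φ n)) :
    IsHyperfinite M := by
  refine isHyperfinite_of_eventually M fun ε hε => ?_
  have hfin := hW.finite
  have h1 := one_mem_entrySpan hl ρ
  -- the estimates below lose the factors `1 - δ`, `1 - δ` and `1 - 2 * δ`
  obtain ⟨δ, hδ, hδ1, hδε⟩ : ∃ δ : ℝ, 0 < δ ∧ δ ≤ 1 / 4 ∧ 4 * δ ≤ ε :=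
    ⟨min (1 / 4) (ε / 4), by positivity, min_le_left _ _,
      by linarith [min_le_right (1 / 4 : ℝ) (ε / 4)]⟩
  have hinv : ∀ᶠ n in atTop,
      (1 - δ) * finrank K ↥(entrySpan ρ * W n) ≤ (finrank K (W n) : ℝ) := by
    filter_upwards [(hW.tendsto_mul (entrySpan ρ) h1).eventually_le_const
      (lt_add_of_pos_right (1 : ℝ) hδ)] with n hn
    have hpos : (0 : ℝ) < finrank K (W n) := by exact_mod_cast hW.finrank_pos n
    rw [div_le_iff₀ hpos] at hn
    nlinarith [mul_le_mul_of_nonneg_left hn (by linarith : (0 : ℝ) ≤ 1 - δ), mul_pos hδ hδ]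
  obtain ⟨m, hm⟩ := hinv.exists
  set V := entrySpan ρ * W m with hV
  have hVbot : V ≠ ⊥ := fun h => hW.ne_bot m <| eq_bot_iff.2 fun x hx => by
    rw [← h]
    simpa using Submodule.mul_mem_mul h1 hx
  have hlarge : ∀ᶠ n in atTop, (finrank K V : ℝ) ≤ δ * finrank K (W n) := by
    have := (tendsto_natCast_atTop_atTop (R := ℝ).comp hdim).const_mul_atTop hδ
    exact this.eventually_ge_atTop _
  refine ⟨M m, ?_⟩
  filter_upwards [hinv, hW.eventually_finrank_core V hδ, hlarge] with n hn hcore hVn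
  obtain ⟨X, hXW, hVX, hX⟩ := hcore
  have : Module.Finite K X := Submodule.finiteDimensional_of_le hXW
  obtain ⟨t, x, hxX, hind, ht⟩ := exists_independent_translates V X hVbot
  obtain ⟨P, ⟨e⟩⟩ := (hM m).exists_submodule_equiv (hM n) x
    (fun i v hv => hVX v hv _ (hxX i)) hind
  refine ⟨P, ?_, t, ⟨e⟩⟩
  have hP : finrank K P = t * finrank K (M m) := by
    have := (hM m).finite
    rw [(e.restrictScalars K).finrank_eq, finrank_pi_fintype]
    simp
  rw [hP]
  have h₁ : (l : ℝ) * finrank K (W m) ≤ finrank K (M m) := by exact_mod_cast (hM m).le_finrank.1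
  have h₂ : (finrank K (M n) : ℝ) ≤ l * finrank K ↥(entrySpan ρ * W n) := by
    exact_mod_cast (hM n).le_finrank.2
  have h₃ : (finrank K X : ℝ) ≤ (t + 1) * finrank K V := by exact_mod_cast ht
  have hl0 : (0 : ℝ) ≤ l := l.cast_nonneg
  have hδ' : (0 : ℝ) ≤ 1 - δ := by linarith
  have hδ2 : (0 : ℝ) ≤ 1 - 2 * δ := by linarith
  have h₄ : (1 - 2 * δ) * finrank K (W n) ≤ t * (finrank K V : ℝ) := by linarith
  have hloss : 1 - ε ≤ (1 - 2 * δ) * (1 - δ) * (1 - δ) := by nlinarith [mul_pos hδ hδ]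
  push_cast
  calc (1 - ε) * (finrank K (M n) : ℝ)
      ≤ (1 - 2 * δ) * (1 - δ) * (1 - δ) * (l * finrank K ↥(entrySpan ρ * W n)) :=
        mul_le_mul hloss h₂ (Nat.cast_nonneg _) (by positivity)
    _ = l * (1 - δ) * ((1 - 2 * δ) * ((1 - δ) * finrank K ↥(entrySpan ρ * W n))) := by ring
    _ ≤ l * (1 - δ) * ((1 - 2 * δ) * finrank K (W n)) := by gcongr
    _ ≤ l * (1 - δ) * (t * finrank K V) := by gcongr
    _ = t * (l * ((1 - δ) * finrank K V)) := by ring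
    _ ≤ t * (l * finrank K (W m)) := by gcongr
    _ ≤ t * finrank K (M m) := by gcongr

/-- A constant sequence is hyperfinite. -/
theorem isHyperfinite_const (M : FinMod K R) : IsHyperfinite fun _ : ℕ => M := by
  refine isHyperfinite_of_eventually _ fun ε hε => ⟨M, .of_forall fun n => ⟨⊤, ?_, 1, ?_⟩⟩
  · have htop : finrank K (⊤ : Submodule R M) = finrank K M :=
      ((Submodule.topEquiv (R := R) (M := M)).restrictScalars K).finrank_eq
    rw [htop]
    exact mul_le_of_le_one_left (Nat.cast_nonneg _) (by linarith)
  · exact ⟨Submodule.topEquiv.trans (LinearEquiv.funUnique (Fin 1) R M).symm⟩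

end Tiling

theorem mainTheorem6 {K : Type uK} {R : Type uR} {D : Type uS}
    [Field K] [Finite K] [Ring R] [Algebra K R] [Module.Finite K R]
    [DivisionRing D] [Algebra K D] (hdim : Module.rank K D ≤ Cardinal.aleph0)
    (hD : IsAmenableAlgebra K D) {l : ℕ} (hl : 1 ≤ l)
    (ρ : R →ₐ[K] Matrix (Fin l) (Fin l) D) :
    IsAmenableElement.{uK, uR, uS} K (rankOfRep (matrixAlgebraRank D l) ρ) := by
  have : Finite R := Module.finite_of_finite K
  have := finite_entrySpan ρ
  refine ⟨⟨_, _, _, _, ρ, isRankAlgebra_matrixAlgebraRank hl, rfl⟩, ?_⟩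
  have hnontriv : ∀ {W : Submodule K D} {M : FinMod K R} {φ : M →ₗ[K] (Fin l → D)},
      Module.Finite K W → W ≠ ⊥ → IsModel ρ W M φ → Nontrivial M := by
    intro W M φ _ hW hM
    have := Submodule.nontrivial_iff_ne_bot.2 hW
    have hpos : 0 < l * Module.finrank K W := Nat.mul_pos hl Module.finrank_pos
    exact Module.nontrivial_of_finrank_pos (hpos.trans_le hM.le_finrank.1)
  by_cases hfin : Module.Finite K D
  · obtain ⟨M, φ, hM⟩ := exists_isModel ρ (⊤ : Submodule K D)
    exact ⟨fun _ => M, fun _ => hnontriv inferInstance top_ne_bot hM, isHyperfinite_const M,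
      fun k m A => tendsto_rankOfMod hl isLeftFoelner_top (fun _ => hM) k m A⟩
  · obtain ⟨W, hW⟩ := hD.exists_isLeftFoelner
    have hex : ∀ n, ∃ (M : FinMod K R) (φ : M →ₗ[K] (Fin l → D)), IsModel ρ (W n) M φ :=
      fun n => have := hW.finite n; exists_isModel ρ (W n)
    choose M φ hM using hex
    exact ⟨M, fun n => hnontriv (hW.finite n) (hW.ne_bot n) (hM n),
      hW.isHyperfinite hl (hW.tendsto_finrank hfin) hM,
      fun k m A => tendsto_rankOfMod hl hW hM k m A⟩
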